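/- Let $M$ be a smooth (finite-dimensional, Hausdorff, second countable) manifold and let $A$ and $B$ be two (local) Lie groups acting on $M$ as (possibly only locally defined) smooth groups of transformations. For $z\in M$ let $\mathfrak a|_z,\mathfrak b|_z\subset T_zM$ be the spaces of values at $z$ of the infinitesimal generators of the $A$-action and of the $B$-action, i.e. the images of the differentials at the identity of $g\mapsto g\cdot z$; these are the tangent spaces at $z$ of the orbits. Here an orbit is the set of all points that can be reached from a given point by finitely many successive transformations. An action is called regular if all its orbits have the same dimension and every point of $M$ has arbitrarily small open neighbourhoods whose intersection with each orbit is connected (possibly empty). Theorem. Suppose that $A$ and $B$ act regularly on $M$ and that, for all $z$ in a neighbourhood of a point $z_0\in M$, the infinitesimal generators of the $A$-action are linearly independent from those of the $B$-action, i.e. $\mathfrak a|_z\cap\mathfrak b|_z=\{0\}$. Then there exist an open neighbourhood $U$ of $z_0$ and an embedded submanifold $\mathcal S_A\subset U$ through $z_0$, of dimension $\dim M-a$ where $a$ is the dimension of the $A$-orbits, such that 1. $\mathcal S_A$ is transverse to the orbits of $A$: $T_p\mathcal S_A+\mathfrak a|_p=T_pM$ for every $p\in\mathcal S_A$; 2.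 $\mathcal S_A$ is invariant under $B$ within $U$: if $z\in\mathcal S_A$, then every point of $U$ that lies on the $B$-orbit of $z$ belongs to $\mathcal S_A$. -/

import Mathlib

open scoped Manifold ContDiff Topology

/-- A (local) Lie group with underlying manifold `G`: an identity, a multiplication that is defined
and smooth on an open set `mulDom` containing `{1} × G` and `G × {1}`, and an inversion that is
defined and smooth on an open neighbourhood `invDom` of the identity. The group axioms hold wherever
both sides are defined. A Lie group is the case `mulDom = univ`, `invDom = univ`. -/
structure LocalLieGroup (F : Type*) [NormedAddCommGroup F] [NormedSpace ℝ F]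
    (G : Type*) [TopologicalSpace G] [ChartedSpace F G] where
  one : G
  mul : G → G → G
  inv : G → G
  mulDom : Set (G × G)
  invDom : Set G
  isOpen_mulDom : IsOpen mulDom
  isOpen_invDom : IsOpen invDom
  one_mul_mem : ∀ g, (one, g) ∈ mulDom
  mul_one_mem : ∀ g, (g, one) ∈ mulDom
  one_mem_invDom : one ∈ invDom
  inv_mul_mem : ∀ g ∈ invDom, (inv g, g) ∈ mulDom
  mul_inv_mem : ∀ g ∈ invDom, (g, inv g) ∈ mulDom
  contMDiffOn_mul : ContMDiffOn (𝓘(ℝ, F).prod 𝓘(ℝ, F)) 𝓘(ℝ, F) ∞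
    (fun p : G × G => mul p.1 p.2) mulDom
  contMDiffOn_inv : ContMDiffOn 𝓘(ℝ, F) 𝓘(ℝ, F) ∞ inv invDom
  one_mul : ∀ g, mul one g = g
  mul_one : ∀ g, mul g one = g
  mul_assoc : ∀ g h k, (g, h) ∈ mulDom → (h, k) ∈ mulDom → (mul g h, k) ∈ mulDom →
    (g, mul h k) ∈ mulDom → mul (mul g h) k = mul g (mul h k)
  inv_mul : ∀ g ∈ invDom, mul (inv g) g = one
  mul_inv : ∀ g ∈ invDom, mul g (inv g) = one

/-- A local group of transformations of the manifold `M`: a smooth map `act`, defined on an open set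
`dom ⊆ G × M` containing `{1} × M`, such that `(g, z) ∈ dom` implies `(g⁻¹, g • z) ∈ dom`, and such
that `1 • z = z` and `g • (h • z) = (g h) • z` wherever both sides are defined.
A smooth action of a Lie group is the case `dom = univ`. -/
structure LocalAction {F : Type*} [NormedAddCommGroup F] [NormedSpace ℝ F]
    {G : Type*} [TopologicalSpace G] [ChartedSpace F G] (L : LocalLieGroup F G)
    (E : Type*) [NormedAddCommGroup E] [NormedSpace ℝ E]
    (M : Type*) [TopologicalSpace M] [ChartedSpace E M] where
  act : G → M → M
  dom : Set (G × M)
  isOpen_dom : IsOpen dom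
  one_mem : ∀ z, (L.one, z) ∈ dom
  inv_mem : ∀ g z, (g, z) ∈ dom → g ∈ L.invDom ∧ (L.inv g, act g z) ∈ dom
  contMDiffOn_act : ContMDiffOn (𝓘(ℝ, F).prod 𝓘(ℝ, E)) 𝓘(ℝ, E) ∞
    (fun p : G × M => act p.1 p.2) dom
  one_act : ∀ z, act L.one z = z
  act_act : ∀ g h z, (h, z) ∈ dom → (g, act h z) ∈ dom → (g, h) ∈ L.mulDom →
    (L.mul g h, z) ∈ dom → act g (act h z) = act (L.mul g h) z

namespace LocalAction

variable {F : Type*} [NormedAddCommGroup F] [NormedSpace ℝ F]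
  {G : Type*} [TopologicalSpace G] [ChartedSpace F G] {L : LocalLieGroup F G}
  {E : Type*} [NormedAddCommGroup E] [NormedSpace ℝ E]
  {M : Type*} [TopologicalSpace M] [ChartedSpace E M]

/-- The orbit of `z`: all points that are reached from `z` by finitely many successive
transformations. For an action that is defined everywhere this is `{g • z | g ∈ G}`. -/
def orbit (w : LocalAction L E M) (z : M) : Set M :=
  {y | Relation.ReflTransGen (fun x x' => ∃ g, (g, x) ∈ w.dom ∧ w.act g x = x') z y}

/-- The infinitesimal generators at `z`: the differential at the identity of `g ↦ g • z`, which maps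
a Lie algebra element `X` to the value at `z` of the infinitesimal generator given by `X`
(the target is written `T_z M`, as `1 • z = z`). -/
noncomputable def generator (w : LocalAction L E M) (z : M) :
    TangentSpace 𝓘(ℝ, F) L.one →L[ℝ] TangentSpace 𝓘(ℝ, E) z :=
  mfderiv 𝓘(ℝ, F) 𝓘(ℝ, E) (fun g => w.act g z) L.one

/-- The subspace of `T_z M` formed by the values at `z` of all infinitesimal generators; it is the
tangent space at `z` of the orbit through `z`. -/
noncomputable def orbitTangent (w : LocalAction L E M) (z : M) :
    Submodule ℝ (TangentSpace 𝓘(ℝ, E) z) :=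
  LinearMap.range (w.generator z).toLinearMap

/-- The dimension of the orbit through `z`. -/
noncomputable def orbitDim (w : LocalAction L E M) (z : M) : ℕ :=
  Module.finrank ℝ (w.orbitTangent z)

/-- All orbits have the same dimension. -/
def IsSemiRegular (w : LocalAction L E M) : Prop :=
  ∀ z z' : M, w.orbitDim z = w.orbitDim z'

/-- Semi-regular, and each point has arbitrarily small neighbourhoods whose intersection with each
orbit is connected (possibly empty). -/
def IsRegular (w : LocalAction L E M) : Prop :=
  w.IsSemiRegular ∧ ∀ z : M, ∀ W ∈ 𝓝 z, ∃ U : Set M, IsOpen U ∧ z ∈ U ∧ U ⊆ W ∧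
    ∀ y : M, IsPreconnected (w.orbit y ∩ U)

end LocalAction

/-- `S` is a (smooth, embedded) `k`-dimensional submanifold of `M`: near each of its points, in some
smooth chart, `S` is a piece of a `k`-dimensional affine subspace. -/
def IsSubmanifold (E : Type*) [NormedAddCommGroup E] [NormedSpace ℝ E]
    {M : Type*} [TopologicalSpace M] [ChartedSpace E M] (k : ℕ) (S : Set M) : Prop :=
  ∀ p ∈ S, ∃ φ ∈ IsManifold.maximalAtlas 𝓘(ℝ, E) ∞ M, p ∈ φ.source ∧
    ∃ V : Submodule ℝ E, Module.finrank ℝ V = k ∧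
      ∀ x ∈ φ.source, (x ∈ S ↔ φ x - φ p ∈ V)

/-- The tangent space of a submanifold `S` at `p`, spanned by the velocities `γ'(0)` of the smooth
curves `γ` in `S` with `γ(0) = p`. -/
noncomputable def submanifoldTangent (E : Type*) [NormedAddCommGroup E] [NormedSpace ℝ E]
    {M : Type*} [TopologicalSpace M] [ChartedSpace E M] (S : Set M) (p : M) :
    Submodule ℝ (TangentSpace 𝓘(ℝ, E) p) :=
  Submodule.span ℝ {v | ∃ γ : ℝ → M, ContMDiffAt 𝓘(ℝ, ℝ) 𝓘(ℝ, E) ∞ γ 0 ∧ γ 0 = p ∧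
    (∀ᶠ t in 𝓝 (0 : ℝ), γ t ∈ S) ∧
    (mfderiv 𝓘(ℝ, ℝ) 𝓘(ℝ, E) γ 0 : ℝ →L[ℝ] E) 1 = v}

namespace LocalAction

variable {F : Type*} [NormedAddCommGroup F] [NormedSpace ℝ F]
  {G : Type*} [TopologicalSpace G] [ChartedSpace F G] {L : LocalLieGroup F G}
  {E : Type*} [NormedAddCommGroup E] [NormedSpace ℝ E]
  {M : Type*} [TopologicalSpace M] [ChartedSpace E M]

/-- `S` is a local cross-section: a submanifold whose dimension is complementary to that of the
orbits through its points and which intersects these orbits transversally. -/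
def IsCrossSection (w : LocalAction L E M) (S : Set M) : Prop :=
  ∃ k : ℕ, IsSubmanifold E k S ∧
    ∀ p ∈ S, k + w.orbitDim p = Module.finrank ℝ E ∧
      submanifoldTangent E S p ⊔ w.orbitTangent p = ⊤

/-- `S` is invariant within the open set `U`: with each of its points it contains the whole part in
`U` of the orbit through that point. -/
def IsInvariantWithin (w : LocalAction L E M) (S U : Set M) : Prop :=
  ∀ z ∈ S, w.orbit z ∩ U ⊆ S

end LocalAction

/-! The cross-section is an affine slice in a chart adapted to `B`. Since all `B`-orbits have the
same dimension, a chart `φ` around `z₀` and a linear map `π` exist such that moving by small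
elements of `B` sweeps out exactly the fibres of `π ∘ φ` near each point (`exists_isFlowBox`). In
this chart the tangent spaces to the `B`-orbits are the constant subspace `ker π`. As it meets the
`A`-directions at `z₀` trivially, it extends to a complement `V` of them, and `S` is the part in `U`
of the slice `φ x - φ z₀ ∈ V`. Transversality to `A` is an open condition, so it persists for small
`U`.

Invariance is the global point, because a `B`-orbit may leave the chart and come back. It returns on
countably many fibres only (`countable_image_orbit`): along chains of transformations the value of
`π ∘ φ` is locally constant once the starting fibre is fixed, and all spaces are second countable.
Regularity makes the part of the orbit in `U` connected, and a connected countable set of values is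
at most one point. So this part lies in one fibre of `π ∘ φ`, and `ker π ≤ V` keeps it in the slice.
-/

/-! ### Preliminaries from calculus, linear algebra and topology. -/

theorem ContDiffAt.exists_openPartialHomeomorph_of_hasFDerivAt_id
    {E : Type*} [NormedAddCommGroup E] [NormedSpace ℝ E] [CompleteSpace E]
    {f : E → E} {a : E} {p : E → Prop} (hf : ∀ᶠ x in 𝓝 a, ContDiffAt ℝ ∞ f x)
    (hf' : HasFDerivAt f (ContinuousLinearMap.id ℝ E) a) (hp : ∀ᶠ x in 𝓝 a, p x) :
    ∃ e : OpenPartialHomeomorph E E, a ∈ e.source ∧ ContDiffOn ℝ ∞ e e.source ∧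
      ContDiffOn ℝ ∞ e.symm e.target ∧ ∀ x ∈ e.source, e x = f x ∧ p x := by
  have h0 : (∞ : WithTop ℕ∞) ≠ 0 := by simp
  have ha := hf.self_of_nhds
  let e₀ := ha.toOpenPartialHomeomorph f
    (f' := ContinuousLinearEquiv.refl ℝ E) hf' h0
  have hae : a ∈ e₀.source := ha.mem_toOpenPartialHomeomorph_source _ h0
  have hcont : ContinuousAt (fderiv ℝ f) a := (ha.fderiv_right (m := 0) (by simp)).continuousAt
  -- Invertibility of the derivative is open; restricting to where it holds makes the inverse smooth
  -- on the whole target.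
  have hinv : ∀ᶠ x in 𝓝 a, ∃ f' : E ≃L[ℝ] E, HasFDerivAt f (f' : E →L[ℝ] E) x := by
    have h1 : ∀ᶠ L : E →L[ℝ] E in 𝓝 (fderiv ℝ f a), ∃ f' : E ≃L[ℝ] E, (f' : E →L[ℝ] E) = L := by
      rw [hf'.fderiv]
      exact (ContinuousLinearEquiv.refl ℝ E).nhds
    filter_upwards [hcont.eventually h1, hf] with x hx hfx
    obtain ⟨f', hf'⟩ := hx
    exact ⟨f', hf' ▸ (hfx.differentiableAt h0).hasFDerivAt⟩
  obtain ⟨s, hs, hso, has⟩ := eventually_nhds_iff.1 (hf.and (hinv.and hp))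
  refine ⟨e₀.restrOpen s hso, ⟨hae, has⟩, ?_, ?_, ?_⟩
  · intro x hx
    exact (hs x hx.2).1.contDiffWithinAt
  · intro y hy
    have hy' := (e₀.restrOpen s hso).map_target hy
    obtain ⟨f', hf'⟩ := (hs _ hy'.2).2.1
    exact ((e₀.restrOpen s hso).contDiffAt_symm hy hf' (hs _ hy'.2).1).contDiffWithinAt
  · intro x hx
    exact ⟨rfl, (hs x hx.2).2.2⟩

/-- With such a generalised inverse `r`, the map `id - T r` is a projection whose kernel is the
range of `T`. -/
theorem LinearMap.exists_comp_comp_eq_self {K V W : Type*} [Field K] [AddCommGroup V] [Module K V]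
    [AddCommGroup W] [Module K W] (T : V →ₗ[K] W) : ∃ r : W →ₗ[K] V, ∀ v, T (r (T v)) = T v := by
  obtain ⟨s, hs⟩ := T.rangeRestrict.exists_rightInverse_of_surjective T.range_rangeRestrict
  obtain ⟨q, hq⟩ := (LinearMap.range T).subtype.exists_leftInverse_of_injective
    (Submodule.ker_subtype _)
  refine ⟨s ∘ₗ q, fun v => ?_⟩
  have h1 : q (T v) = T.rangeRestrict v := LinearMap.congr_fun hq (T.rangeRestrict v)
  have h2 := congrArg Subtype.val (LinearMap.congr_fun hs (T.rangeRestrict v))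
  simp only [LinearMap.comp_apply, h1]
  exact h2

theorem eventually_eq_of_eventually_hasMFDerivAt_zero
    {F : Type*} [NormedAddCommGroup F] [NormedSpace ℝ F]
    {G : Type*} [TopologicalSpace G] [ChartedSpace F G] [IsManifold 𝓘(ℝ, F) ∞ G]
    {E : Type*} [NormedAddCommGroup E] [NormedSpace ℝ E] {f : G → E} {g : G}
    (h : ∀ᶠ x in 𝓝 g, HasMFDerivAt 𝓘(ℝ, F) 𝓘(ℝ, E) f x 0) : ∀ᶠ x in 𝓝 g, f x = f g := by
  set κ := chartAt F g
  have hκ : κ ∈ IsManifold.maximalAtlas 𝓘(ℝ, F) ∞ G := IsManifold.chart_mem_maximalAtlas g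
  have hg : g ∈ κ.source := mem_chart_source F g
  have h1 : ∀ᶠ v in 𝓝 (κ g), HasFDerivAt (f ∘ κ.symm) (0 : F →L[ℝ] E) v := by
    have h2 : ContinuousAt κ.symm (κ g) := κ.continuousAt_symm (κ.map_source hg)
    have h3 := h2.eventually (p := fun x => HasMFDerivAt 𝓘(ℝ, F) 𝓘(ℝ, E) f x 0)
      (by rwa [κ.left_inv hg])
    filter_upwards [h3, κ.open_target.mem_nhds (κ.map_source hg)] with v hv hvt
    have h4 := (contMDiffAt_symm_of_mem_maximalAtlas hκ hvt).mdifferentiableAt (by simp)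
    have h5 := hv.comp v h4.hasMFDerivAt
    rw [hasMFDerivAt_iff_hasFDerivAt] at h5
    rwa [ContinuousLinearMap.zero_comp] at h5
  obtain ⟨ε, hε, hb⟩ := Metric.eventually_nhds_iff_ball.1 h1
  have h6 : ∀ v ∈ Metric.ball (κ g) ε, (f ∘ κ.symm) v = (f ∘ κ.symm) (κ g) := fun v hv =>
    (convex_ball (κ g) ε).is_const_of_fderivWithin_eq_zero (𝕜 := ℝ)
      (fun x hx => (hb x hx).differentiableAt.differentiableWithinAt)
      (fun x hx => by
        rw [fderivWithin_of_isOpen Metric.isOpen_ball hx, (hb x hx).fderiv])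
      hv (Metric.mem_ball_self hε)
  filter_upwards [(κ.continuousAt hg).eventually (Metric.ball_mem_nhds _ hε),
    κ.open_source.mem_nhds hg] with x hx hxs
  simpa [κ.left_inv hxs, κ.left_inv hg] using h6 _ hx

/-- By the Lindelöf property, countably many relative neighbourhoods on which `f` is constant cover
`s`. -/
theorem Set.Countable.image_of_eventually_eq {X Y : Type*} [TopologicalSpace X]
    [SecondCountableTopology X] {f : X → Y} {s : Set X}
    (h : ∀ x ∈ s, ∀ᶠ x' in 𝓝[s] x, f x' = f x) : (f '' s).Countable := by
  obtain ⟨t, -, htc, hst⟩ := TopologicalSpace.countable_cover_nhdsWithin h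
  refine (htc.image f).mono ?_
  rintro _ ⟨x, hx, rfl⟩
  obtain ⟨y, hy, hxy⟩ := Set.mem_iUnion₂.1 (hst hx)
  exact ⟨y, hy, Eq.symm hxy⟩

/-- Composing with a right inverse of `T x₀` gives the identity at `x₀`, and invertible operators
form an open set. -/
theorem ContinuousAt.eventually_surjective {X E F : Type*} [TopologicalSpace X]
    [NormedAddCommGroup E] [NormedSpace ℝ E] [FiniteDimensional ℝ E]
    [NormedAddCommGroup F] [NormedSpace ℝ F] [FiniteDimensional ℝ F]
    {T : X → F →L[ℝ] E} {x₀ : X} (hT : ContinuousAt T x₀) (h : Function.Surjective (T x₀)) :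
    ∀ᶠ x in 𝓝 x₀, Function.Surjective (T x) := by
  obtain ⟨r, hr⟩ := (T x₀).toLinearMap.exists_rightInverse_of_surjective
    (LinearMap.range_eq_top.2 h)
  have h1 : ContinuousAt (fun x => (T x).comp r.toContinuousLinearMap) x₀ :=
    hT.clm_comp continuousAt_const
  have h2 : (T x₀).comp r.toContinuousLinearMap
      = ((ContinuousLinearEquiv.refl ℝ E : E ≃L[ℝ] E) : E →L[ℝ] E) := by
    ext v; exact LinearMap.congr_fun hr v
  have h3 := h1.eventually (p := fun L => L ∈ Set.range ((↑) : (E ≃L[ℝ] E) → E →L[ℝ] E))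
    (by simp only [h2]; exact (ContinuousLinearEquiv.refl ℝ E).nhds)
  filter_upwards [h3] with x ⟨e, he⟩ y
  refine ⟨r (e.symm y), ?_⟩
  have := DFunLike.congr_fun he (e.symm y)
  simpa using this.symm

theorem mdifferentiableAt_of_mem_maximalAtlas_infty
    {E : Type*} [NormedAddCommGroup E] [NormedSpace ℝ E]
    {M : Type*} [TopologicalSpace M] [ChartedSpace E M]
    {φ : OpenPartialHomeomorph M E}
    (hφ : φ ∈ IsManifold.maximalAtlas 𝓘(ℝ, E) ∞ M) {x : M} (hx : x ∈ φ.source) :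
    MDifferentiableAt 𝓘(ℝ, E) 𝓘(ℝ, E) φ x :=
  (contMDiffAt_of_mem_maximalAtlas hφ hx).mdifferentiableAt (by simp)

theorem mfderiv_injective_of_mem_maximalAtlas
    {E : Type*} [NormedAddCommGroup E] [NormedSpace ℝ E]
    {M : Type*} [TopologicalSpace M] [ChartedSpace E M] [IsManifold 𝓘(ℝ, E) ∞ M]
    {φ : OpenPartialHomeomorph M E}
    (hφ : φ ∈ IsManifold.maximalAtlas 𝓘(ℝ, E) ∞ M) {x : M} (hx : x ∈ φ.source) :
    Function.Injective (mfderiv 𝓘(ℝ, E) 𝓘(ℝ, E) φ x) := by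
  have : IsManifold 𝓘(ℝ, E) 1 M := .of_le (n := ∞) (by simp)
  exact OpenPartialHomeomorph.MDifferentiable.mfderiv_injective (e := φ)
    ⟨(contMDiffOn_of_mem_maximalAtlas hφ).mdifferentiableOn (by simp),
      (contMDiffOn_symm_of_mem_maximalAtlas hφ).mdifferentiableOn (by simp)⟩ hx

/-! ### The local group law near a given transformation. -/

namespace LocalAction

variable {F : Type*} [NormedAddCommGroup F] [NormedSpace ℝ F]
  {G : Type*} [TopologicalSpace G] [ChartedSpace F G] {L : LocalLieGroup F G}
  {E : Type*} [NormedAddCommGroup E] [NormedSpace ℝ E]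
  {M : Type*} [TopologicalSpace M] [ChartedSpace E M]

theorem continuousAt_act (w : LocalAction L E M) {g : G} {z : M} (h : (g, z) ∈ w.dom) :
    ContinuousAt (fun p : G × M => w.act p.1 p.2) (g, z) :=
  (w.contMDiffOn_act.contMDiffAt (w.isOpen_dom.mem_nhds h)).continuousAt

theorem contMDiffAt_act_left (w : LocalAction L E M) {g : G} {z : M} (h : (g, z) ∈ w.dom) :
    ContMDiffAt 𝓘(ℝ, F) 𝓘(ℝ, E) ∞ (fun g => w.act g z) g :=
  (w.contMDiffOn_act.contMDiffAt (w.isOpen_dom.mem_nhds h)).comp g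
    (contMDiffAt_id.prodMk contMDiffAt_const)

theorem contMDiffAt_mul_inv (w : LocalAction L E M) {g : G} {z : M} (h : (g, z) ∈ w.dom) :
    ContMDiffAt 𝓘(ℝ, F) 𝓘(ℝ, F) ∞ (fun g' => L.mul g' (L.inv g)) g :=
  ContMDiffAt.comp g (f := fun g' => (g', L.inv g)) (L.contMDiffOn_mul.contMDiffAt
    (L.isOpen_mulDom.mem_nhds (L.mul_inv_mem g (w.inv_mem g z h).1)))
    (contMDiffAt_id.prodMk contMDiffAt_const)

theorem tendsto_mul_inv (w : LocalAction L E M) {g : G} {z : M} (h : (g, z) ∈ w.dom) :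
    Filter.Tendsto (fun g' => L.mul g' (L.inv g)) (𝓝 g) (𝓝 L.one) := by
  have := (w.contMDiffAt_mul_inv h).continuousAt.tendsto
  rwa [L.mul_inv g (w.inv_mem g z h).1] at this

/-- Moving the base point from `z` to `g • z` turns elements near `g` into elements near the
identity; closeness to `g` ensures that all products involved are defined. -/
theorem eventually_act_eq (w : LocalAction L E M) {g : G} {z : M} (h : (g, z) ∈ w.dom) :
    ∀ᶠ g' in 𝓝 g, (L.mul g' (L.inv g), w.act g z) ∈ w.dom ∧
      w.act (L.mul g' (L.inv g)) (w.act g z) = w.act g' z := by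
  have hi := (w.inv_mem g z h).1
  have ht := w.tendsto_mul_inv h
  have h1 : ∀ᶠ g' in 𝓝 g, (g', L.inv g) ∈ L.mulDom :=
    (ContinuousAt.prodMk continuousAt_id continuousAt_const).eventually
      (L.isOpen_mulDom.mem_nhds (L.mul_inv_mem g hi))
  have h2 : ∀ᶠ g' in 𝓝 g, (L.mul g' (L.inv g), g) ∈ L.mulDom :=
    (ht.prodMk_nhds tendsto_const_nhds).eventually (L.isOpen_mulDom.mem_nhds (L.one_mul_mem g))
  have h3 : ∀ᶠ g' in 𝓝 g, (L.mul g' (L.inv g), w.act g z) ∈ w.dom :=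
    (ht.prodMk_nhds tendsto_const_nhds).eventually (w.isOpen_dom.mem_nhds (w.one_mem _))
  have h4 : ∀ᶠ g' in 𝓝 g, (g', z) ∈ w.dom :=
    (ContinuousAt.prodMk continuousAt_id continuousAt_const).eventually (w.isOpen_dom.mem_nhds h)
  filter_upwards [h1, h2, h3, h4] with g' h1 h2 h3 h4
  have h5 : L.mul (L.mul g' (L.inv g)) g = g' := by
    rw [L.mul_assoc g' (L.inv g) g h1 (L.inv_mul_mem g hi) h2
      (by rw [L.inv_mul g hi]; exact L.mul_one_mem g'), L.inv_mul g hi, L.mul_one]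
  refine ⟨h3, ?_⟩
  rw [w.act_act _ _ _ h h3 h2 (by rwa [h5]), h5]

/-- The witness is `g' k g⁻¹`, which tends to the identity as `(g', k)` tends to `(g, 1)`. -/
theorem eventually_act_act (w : LocalAction L E M) {g : G} {z : M} (h : (g, z) ∈ w.dom)
    {N : Set G} (hN : N ∈ 𝓝 L.one) :
    ∀ᶠ p : G × G in 𝓝 (g, L.one), ∃ k ∈ N, w.act p.1 (w.act p.2 z) = w.act k (w.act g z) := by
  have hmul : ContinuousAt (fun p : G × G => L.mul p.1 p.2) (g, L.one) :=
    (L.contMDiffOn_mul.contMDiffAt (L.isOpen_mulDom.mem_nhds (L.mul_one_mem g))).continuousAt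
  have hact : ContinuousAt (fun p : G × G => w.act p.2 z) (g, L.one) :=
    ContinuousAt.comp (g := fun k => w.act k z)
      (w.contMDiffAt_act_left (w.one_mem z)).continuousAt continuousAt_snd
  have h1 : ∀ᶠ p : G × G in 𝓝 (g, L.one), (p.2, z) ∈ w.dom :=
    (continuousAt_snd.prodMk continuousAt_const).eventually (w.isOpen_dom.mem_nhds (w.one_mem z))
  have h2 : ∀ᶠ p : G × G in 𝓝 (g, L.one), (p.1, w.act p.2 z) ∈ w.dom :=
    (continuousAt_fst.prodMk hact).eventually
      (w.isOpen_dom.mem_nhds (by simpa only [w.one_act] using h))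
  have h3 : ∀ᶠ p : G × G in 𝓝 (g, L.one), (p.1, p.2) ∈ L.mulDom :=
    L.isOpen_mulDom.mem_nhds (L.mul_one_mem g)
  have h4 : ∀ᶠ p : G × G in 𝓝 (g, L.one), (L.mul p.1 p.2, z) ∈ w.dom :=
    (hmul.prodMk continuousAt_const).eventually
      (w.isOpen_dom.mem_nhds (by simpa only [L.mul_one] using h))
  have h5 : ∀ᶠ p : G × G in 𝓝 (g, L.one), w.act (L.mul (L.mul p.1 p.2) (L.inv g)) (w.act g z)
      = w.act (L.mul p.1 p.2) z ∧ L.mul (L.mul p.1 p.2) (L.inv g) ∈ N :=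
    hmul.eventually (p := fun k => w.act (L.mul k (L.inv g)) (w.act g z) = w.act k z ∧
      L.mul k (L.inv g) ∈ N) (by
        simp only [L.mul_one]
        exact ((w.eventually_act_eq h).mono fun _ h => h.2).and ((w.tendsto_mul_inv h) hN))
  filter_upwards [h1, h2, h3, h4, h5] with p h1 h2 h3 h4 h5
  exact ⟨_, h5.2, by rw [h5.1, w.act_act _ _ _ h1 h2 h3 h4]⟩

/-! ### Derivatives along the infinitesimal generators. -/

/-- The derivative at `x` of a function `f` on `M` along the infinitesimal generators. -/
noncomputable def derivAlong (w : LocalAction L E M) {E' : Type*} [NormedAddCommGroup E']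
    [NormedSpace ℝ E'] (f : M → E') (x : M) : F →L[ℝ] E' :=
  mfderiv 𝓘(ℝ, F) 𝓘(ℝ, E') (fun g => f (w.act g x)) L.one

section derivAlong

variable {E' : Type*} [NormedAddCommGroup E'] [NormedSpace ℝ E'] {f : M → E'} {x : M}

theorem derivAlong_apply (w : LocalAction L E M)
    (hf : MDifferentiableAt 𝓘(ℝ, E) 𝓘(ℝ, E') f x) (v : F) :
    w.derivAlong f x v = mfderiv 𝓘(ℝ, E) 𝓘(ℝ, E') f x (w.generator x v) := by
  have h1 := (w.contMDiffAt_act_left (w.one_mem x)).mdifferentiableAt (by simp)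
  have h2 := mfderiv_comp_of_eq hf h1 (w.one_act x)
  have h3 : ∀ y, y = x → (mfderiv 𝓘(ℝ, E) 𝓘(ℝ, E') f y : E →L[ℝ] E') =
    (mfderiv 𝓘(ℝ, E) 𝓘(ℝ, E') f x : E →L[ℝ] E') := by rintro _ rfl; rfl
  exact (DFunLike.congr_fun h2 v).trans
    (DFunLike.congr_fun (h3 (w.act L.one x) (w.one_act x)) (w.generator x v : E))

theorem finrank_range_derivAlong (w : LocalAction L E M)
    (hf : MDifferentiableAt 𝓘(ℝ, E) 𝓘(ℝ, E') f x)
    (hi : Function.Injective (mfderiv 𝓘(ℝ, E) 𝓘(ℝ, E') f x)) :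
    Module.finrank ℝ (LinearMap.range (w.derivAlong f x).toLinearMap) = w.orbitDim x := by
  have h : (w.derivAlong f x).toLinearMap = LinearMap.comp
      (M₂ := E) (mfderiv 𝓘(ℝ, E) 𝓘(ℝ, E') f x : E →L[ℝ] E').toLinearMap
      (w.generator x : F →L[ℝ] E).toLinearMap :=
    LinearMap.ext fun v => w.derivAlong_apply hf v
  have h' : ∀ (l : E →ₗ[ℝ] E') (k : F →ₗ[ℝ] E), Function.Injective l →
      Module.finrank ℝ (LinearMap.range (l ∘ₗ k)) = Module.finrank ℝ (LinearMap.range k) := by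
    intro l k hl
    rw [LinearMap.range_comp]
    exact (Submodule.equivMapOfInjective l hl _).finrank_eq.symm
  exact (congrArg (fun T : F →ₗ[ℝ] E' => Module.finrank ℝ (LinearMap.range T)) h).trans (h' _ _ hi)

/-- The equations `hg` and `hD` are hypotheses because tangent spaces depend on the point: rewriting
`g g⁻¹ = 1` inside the derivative is thereby avoided. -/
theorem hasMFDerivAt_comp_act (w : LocalAction L E M)
    (hf : MDifferentiableAt 𝓘(ℝ, E) 𝓘(ℝ, E') f x) {g : G} (hg : g = L.one)
    {D : F →L[ℝ] E'} (hD : w.derivAlong f x = D) :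
    HasMFDerivAt 𝓘(ℝ, F) 𝓘(ℝ, E') (fun g => f (w.act g x)) g D := by
  subst hg hD
  have h1 := (w.contMDiffAt_act_left (w.one_mem x)).mdifferentiableAt (by simp)
  exact (MDifferentiableAt.comp_of_eq (x := L.one) (f := fun g => w.act g x) (g := f) hf h1
    (w.one_act x)).hasMFDerivAt

/-- A function whose derivatives along the infinitesimal generators vanish is locally constant
along the orbits. -/
theorem eventually_comp_act_eq [IsManifold 𝓘(ℝ, F) ∞ G] (w : LocalAction L E M)
    (hf : ∀ᶠ y in 𝓝 x, MDifferentiableAt 𝓘(ℝ, E) 𝓘(ℝ, E') f y ∧ w.derivAlong f y = 0) :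
    ∀ᶠ g in 𝓝 L.one, f (w.act g x) = f x := by
  have hx := w.one_mem x
  have h1 : ∀ᶠ g in 𝓝 L.one, (g, x) ∈ w.dom :=
    (ContinuousAt.prodMk continuousAt_id continuousAt_const).eventually (w.isOpen_dom.mem_nhds hx)
  have h2 := (w.contMDiffAt_act_left hx).continuousAt.eventually (by simpa only [w.one_act] using hf)
  have h3 := eventually_eq_of_eventually_hasMFDerivAt_zero (F := F) (f := fun g => f (w.act g x))
    (g := L.one) (by
      filter_upwards [h1, h2] with g h1 h2
      -- Near `g` the function is `g' ↦ f ((g' g⁻¹) • (g • x))`, so the chain rule reduces its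
      -- derivative at `g` to the vanishing derivative along the generators at `g • x`.
      have hq : L.mul g (L.inv g) = L.one := L.mul_inv g (w.inv_mem g x h1).1
      have h3 := w.hasMFDerivAt_comp_act h2.1 hq h2.2
      have h2 := ((w.contMDiffAt_mul_inv h1).mdifferentiableAt (by simp)).hasMFDerivAt
      have h4 : HasMFDerivAt 𝓘(ℝ, F) 𝓘(ℝ, E') ((fun k => f (w.act k (w.act g x))) ∘
          fun g' => L.mul g' (L.inv g)) g (0 : F →L[ℝ] E') :=
        Eq.mp (congrArg (fun D : F →L[ℝ] E' => HasMFDerivAt 𝓘(ℝ, F) 𝓘(ℝ, E')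
            ((fun k => f (w.act k (w.act g x))) ∘ fun g' => L.mul g' (L.inv g)) g D)
          (ContinuousLinearMap.zero_comp (show F →L[ℝ] F from
            mfderiv 𝓘(ℝ, F) 𝓘(ℝ, F) (fun g' => L.mul g' (L.inv g)) g)))
          (h3.comp g h2)
      exact h4.congr_of_eventuallyEq
        ((w.eventually_act_eq h1).mono fun _ h => congrArg f h.2.symm))
  simpa only [w.one_act] using h3

end derivAlong

/-! ### The action in coordinates. -/

/-- The action written in the preferred chart of the group at the identity and a chart `φ`. -/
noncomputable def coordAct (w : LocalAction L E M) (φ : OpenPartialHomeomorph M E) (q : F × E) : E :=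
  φ (w.act ((chartAt F L.one).symm q.1) (φ.symm q.2))

theorem eventually_coordAct [IsManifold 𝓘(ℝ, F) ∞ G] (w : LocalAction L E M)
    {φ : OpenPartialHomeomorph M E} (hφ : φ ∈ IsManifold.maximalAtlas 𝓘(ℝ, E) ∞ M) {z : M}
    (hz : z ∈ φ.source) :
    ∀ᶠ q : F × E in 𝓝 (chartAt F L.one L.one, φ z),
      q.1 ∈ (chartAt F L.one).target ∧ q.2 ∈ φ.target ∧
      ((chartAt F L.one).symm q.1, φ.symm q.2) ∈ w.dom ∧
      w.act ((chartAt F L.one).symm q.1) (φ.symm q.2) ∈ φ.source ∧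
      ContDiffAt ℝ ∞ (w.coordAct φ) q := by
  set κ := chartAt F L.one
  have hκ : κ ∈ IsManifold.maximalAtlas 𝓘(ℝ, F) ∞ G := IsManifold.chart_mem_maximalAtlas _
  have h1 : L.one ∈ κ.source := mem_chart_source F L.one
  have ht1 : ∀ᶠ q : F × E in 𝓝 (κ L.one, φ z), q.1 ∈ κ.target :=
    continuousAt_fst.eventually (κ.open_target.mem_nhds (κ.map_source h1))
  have ht2 : ∀ᶠ q : F × E in 𝓝 (κ L.one, φ z), q.2 ∈ φ.target :=
    continuousAt_snd.eventually (φ.open_target.mem_nhds (φ.map_source hz))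
  have hc : ContinuousAt (fun q : F × E => (κ.symm q.1, φ.symm q.2)) (κ L.one, φ z) :=
    (ContinuousAt.comp (g := κ.symm) (f := fun q : F × E => q.1)
      (κ.continuousAt_symm (κ.map_source h1)) continuousAt_fst).prodMk
      (ContinuousAt.comp (g := φ.symm) (f := fun q : F × E => q.2)
        (φ.continuousAt_symm (φ.map_source hz)) continuousAt_snd)
  have hc' : (fun q : F × E => (κ.symm q.1, φ.symm q.2)) (κ L.one, φ z) = (L.one, z) := by
    simp only [κ.left_inv h1, φ.left_inv hz]
  have hd : ∀ᶠ q : F × E in 𝓝 (κ L.one, φ z), (κ.symm q.1, φ.symm q.2) ∈ w.dom :=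
    hc.eventually (by rw [hc']; exact w.isOpen_dom.mem_nhds (w.one_mem z))
  have hs : ∀ᶠ q : F × E in 𝓝 (κ L.one, φ z), w.act (κ.symm q.1) (φ.symm q.2) ∈ φ.source :=
    hc.eventually (p := fun p => w.act p.1 p.2 ∈ φ.source) (by
      rw [hc']
      exact (w.continuousAt_act (w.one_mem z)).eventually
        (by simpa only [w.one_act] using φ.open_source.eventually_mem hz))
  filter_upwards [ht1, ht2, hd, hs] with q ht1 ht2 hd hs
  refine ⟨ht1, ht2, hd, hs, ?_⟩
  rw [← contMDiffAt_iff_contDiffAt]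
  have k1 : ContMDiffAt 𝓘(ℝ, F × E) 𝓘(ℝ, F) ∞ (fun q : F × E => κ.symm q.1) q :=
    ContMDiffAt.comp q (g := κ.symm) (f := fun q : F × E => q.1)
      (contMDiffAt_symm_of_mem_maximalAtlas hκ ht1)
      (contMDiffAt_iff_contDiffAt.2 contDiffAt_fst)
  have k2 : ContMDiffAt 𝓘(ℝ, F × E) 𝓘(ℝ, E) ∞ (fun q : F × E => φ.symm q.2) q :=
    ContMDiffAt.comp q (g := φ.symm) (f := fun q : F × E => q.2)
      (contMDiffAt_symm_of_mem_maximalAtlas hφ ht2)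
      (contMDiffAt_iff_contDiffAt.2 contDiffAt_snd)
  have k3 := (w.contMDiffOn_act.contMDiffAt (w.isOpen_dom.mem_nhds hd))
  have k4 : ContMDiffAt 𝓘(ℝ, F × E) 𝓘(ℝ, E) ∞
      (fun q : F × E => w.act (κ.symm q.1) (φ.symm q.2)) q :=
    ContMDiffAt.comp q (g := fun p : G × M => w.act p.1 p.2)
      (f := fun q : F × E => (κ.symm q.1, φ.symm q.2)) k3 (k1.prodMk k2)
  exact ContMDiffAt.comp q (g := φ) (f := fun q : F × E => w.act (κ.symm q.1) (φ.symm q.2))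
    (contMDiffAt_of_mem_maximalAtlas hφ hs) k4

theorem hasFDerivAt_comp_act (w : LocalAction L E M)
    {E' : Type*} [NormedAddCommGroup E'] [NormedSpace ℝ E'] {f : M → E'} {x : M}
    (hf : MDifferentiableAt 𝓘(ℝ, E) 𝓘(ℝ, E') f x) :
    HasFDerivAt (fun v => f (w.act ((chartAt F L.one).symm v) x)) (w.derivAlong f x)
      (chartAt F L.one L.one) := by
  have h : HasFDerivWithinAt (fun v => f (w.act ((chartAt F L.one).symm v) x))
      (w.derivAlong f x) (Set.range 𝓘(ℝ, F)) (chartAt F L.one L.one) :=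
    (w.hasMFDerivAt_comp_act hf rfl rfl).2
  simpa using h

/-- The two partial derivatives determine the total one; the one in the space variable is the
identity because `1` acts trivially. -/
theorem hasFDerivAt_coordAct [IsManifold 𝓘(ℝ, F) ∞ G] (w : LocalAction L E M)
    {φ : OpenPartialHomeomorph M E} (hφ : φ ∈ IsManifold.maximalAtlas 𝓘(ℝ, E) ∞ M) {z : M}
    (hz : z ∈ φ.source) :
    HasFDerivAt (w.coordAct φ)
      ((w.derivAlong φ z).coprod (ContinuousLinearMap.id ℝ E)) (chartAt F L.one L.one, φ z) := by
  have h := (w.eventually_coordAct hφ hz).self_of_nhds.2.2.2.2.differentiableAt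
    (by simp) |>.hasFDerivAt
  have h1 := HasFDerivAt.comp (f := fun v : F => (v, φ z)) (chartAt F L.one L.one) h
    (hasFDerivAt_prodMk_left _ (φ z))
  have h2 := HasFDerivAt.comp (f := fun v : E => (chartAt F L.one L.one, v)) (φ z) h
    (hasFDerivAt_prodMk_right (chartAt F L.one L.one) (φ z))
  have h3 : w.coordAct φ ∘ (fun v => (v, φ z)) =
      fun v => φ (w.act ((chartAt F L.one).symm v) z) := by
    ext v; simp [coordAct, φ.left_inv hz]
  have h4 : w.coordAct φ ∘ (fun v => (chartAt F L.one L.one, v)) =ᶠ[𝓝 (φ z)] id := by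
    filter_upwards [φ.open_target.mem_nhds (φ.map_source hz)] with v hv
    simp [coordAct, w.one_act, φ.right_inv hv]
  rw [h3] at h1
  have h5 := h1.unique (w.hasFDerivAt_comp_act
    (mdifferentiableAt_of_mem_maximalAtlas_infty hφ hz))
  have h6 := (h2.congr_of_eventuallyEq h4.symm).unique (hasFDerivAt_id _)
  have h7 : (w.derivAlong φ z).coprod (ContinuousLinearMap.id ℝ E) =
      fderiv ℝ (w.coordAct φ) (chartAt F L.one L.one, φ z) := by
    rw [← h5, ← h6]
    ext v <;> simp
  exact h7 ▸ h

/-! ### Flow boxes. -/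

/-- `φ` is a chart in which the fibres of the linear map `π` are, locally, the orbits. -/
structure IsFlowBox (w : LocalAction L E M) (φ : OpenPartialHomeomorph M E) (π : E →L[ℝ] E) :
    Prop where
  mem_maximalAtlas : φ ∈ IsManifold.maximalAtlas 𝓘(ℝ, E) ∞ M
  ker_eq : ∀ x ∈ φ.source,
    LinearMap.ker π.toLinearMap = LinearMap.range (w.derivAlong φ x).toLinearMap
  reach : ∀ x ∈ φ.source, ∀ N ∈ 𝓝 L.one, ∀ᶠ x' in 𝓝 x, π (φ x') = π (φ x) →
    ∃ h ∈ N, (h, x) ∈ w.dom ∧ w.act h x = x'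

theorem exists_isFlowBox [IsManifold 𝓘(ℝ, F) ∞ G] [FiniteDimensional ℝ E]
    [IsManifold 𝓘(ℝ, E) ∞ M] (w : LocalAction L E M)
    (hw : w.IsSemiRegular) (m : M) :
    ∃ (φ : OpenPartialHomeomorph M E) (π : E →L[ℝ] E), m ∈ φ.source ∧ w.IsFlowBox φ π := by
  have : CompleteSpace E := FiniteDimensional.complete ℝ E
  set κ := chartAt F L.one with hκdef
  set ψ := chartAt E m with hψdef
  have hκ : κ ∈ IsManifold.maximalAtlas 𝓘(ℝ, F) ∞ G := IsManifold.chart_mem_maximalAtlas _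
  have hψ : ψ ∈ IsManifold.maximalAtlas 𝓘(ℝ, E) ∞ M := IsManifold.chart_mem_maximalAtlas _
  have h1 : L.one ∈ κ.source := mem_chart_source F L.one
  have hm : m ∈ ψ.source := mem_chart_source E m
  set T := w.derivAlong ψ m with hT
  obtain ⟨r₀, hr₀⟩ := T.toLinearMap.exists_comp_comp_eq_self
  set r : E →L[ℝ] F := r₀.toContinuousLinearMap
  have hr : ∀ v, T (r (T v)) = T v := hr₀
  set π : E →L[ℝ] E := ContinuousLinearMap.id ℝ E - T.comp r with hπ
  have hker : LinearMap.ker π.toLinearMap = LinearMap.range T.toLinearMap := by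
    ext u
    simp only [LinearMap.mem_ker, LinearMap.mem_range, ContinuousLinearMap.coe_coe]
    constructor
    · intro h
      refine ⟨r u, ?_⟩
      have : u - T (r u) = 0 := h
      exact (sub_eq_zero.1 this).symm
    · rintro ⟨v, rfl⟩
      change T v - T (r (T v)) = 0
      rw [hr, sub_self]
  -- Split `e` into a motion `r e` in the group and a displacement `π e` across the orbits. The
  -- derivative of the action along `ι` is then `T r + π = id`, so the inverse function theorem
  -- applies.
  let ι : E → F × E := fun e => (κ L.one + r e, ψ m + π e)
  have hι : HasFDerivAt ι (r.prod π) 0 :=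
    (r.hasFDerivAt.const_add _).prodMk (π.hasFDerivAt.const_add _)
  have hιs : ContDiff ℝ ∞ ι :=
    (contDiff_const.add r.contDiff).prodMk (contDiff_const.add π.contDiff)
  have hι0 : ι 0 = (κ L.one, ψ m) := by simp [ι]
  have hgood := w.eventually_coordAct hψ hm
  rw [← hκdef, ← hι0] at hgood
  have hgood' := hιs.continuous.continuousAt.eventually hgood
  have hder : HasFDerivAt (w.coordAct ψ ∘ ι) (ContinuousLinearMap.id ℝ E) 0 := by
    have h2 := w.hasFDerivAt_coordAct hψ hm
    rw [← hκdef, ← hι0] at h2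
    convert h2.comp 0 hι using 1
    ext v
    simp [hπ, hT]
  obtain ⟨e₀, h0, he₀, he₀', hP⟩ := ContDiffAt.exists_openPartialHomeomorph_of_hasFDerivAt_id
    (f := w.coordAct ψ ∘ ι) (a := 0)
    (hgood'.mono fun x hx => hx.2.2.2.2.comp x hιs.contDiffAt) hder hgood'
  let γ : E → G := fun e => κ.symm (κ L.one + r e)
  let σ : E → M := fun e => ψ.symm (ψ m + π e)
  have hdom : ∀ e ∈ e₀.source, (γ e, σ e) ∈ w.dom := fun e he => (hP e he).2.2.2.1
  have hact : ∀ e ∈ e₀.source, w.act (γ e) (σ e) = ψ.symm (e₀ e) := fun e he => by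
    rw [(hP e he).1]
    exact (ψ.left_inv (hP e he).2.2.2.2.1).symm
  have hact_mem : ∀ e ∈ e₀.source, e₀ e ∈ ψ.target := fun e he => by
    rw [(hP e he).1]
    exact ψ.map_source (hP e he).2.2.2.2.1
  have hγs : ∀ e ∈ e₀.source, ContMDiffAt 𝓘(ℝ, E) 𝓘(ℝ, F) ∞ γ e := fun e he =>
    ContMDiffAt.comp e (g := κ.symm) (f := fun e => κ L.one + r e)
      (contMDiffAt_symm_of_mem_maximalAtlas hκ (hP e he).2.1)
      (contMDiffAt_iff_contDiffAt.2 (contDiff_const.add r.contDiff).contDiffAt)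
  have hσ : ∀ e e', π e = π e' → σ e = σ e' := fun e e' h => by simp only [σ, h]
  set φ := ψ.trans e₀.symm with hφdef
  have hφs : ∀ x ∈ φ.source, φ x ∈ e₀.source := fun x hx =>
    e₀.map_target (by simpa [hφdef] using hx.2)
  have hφinv : ∀ e ∈ e₀.source, φ (w.act (γ e) (σ e)) = e := fun e he => by
    rw [hact e he]
    simp [hφdef, ψ.right_inv (hact_mem e he), e₀.left_inv he]
  have hφact : ∀ x ∈ φ.source, w.act (γ (φ x)) (σ (φ x)) = x := fun x hx => by
    rw [hact _ (hφs x hx)]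
    have hx' : x ∈ ψ.source ∧ ψ x ∈ e₀.target := by simpa [hφdef] using hx
    simp [hφdef, e₀.right_inv hx'.2, ψ.left_inv hx'.1]
  have hφ : φ ∈ IsManifold.maximalAtlas 𝓘(ℝ, E) ∞ M := by
    apply OpenPartialHomeomorph.mem_maximalAtlas_of_contMDiffOn
    · exact (contMDiffOn_iff_contDiffOn.2 he₀').comp
        ((contMDiffOn_of_mem_maximalAtlas hψ).mono fun x hx => hx.1) (fun x hx => hx.2)
    · exact (contMDiffOn_symm_of_mem_maximalAtlas hψ).comp
        ((contMDiffOn_iff_contDiffOn.2 he₀).mono fun x hx => hx.1) (fun x hx => hx.2)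
  refine ⟨φ, π, ?_, hφ, ?_, ?_⟩
  · have : w.coordAct ψ (ι 0) = ψ m := by
      simp [hι0, coordAct, ← hκdef, κ.left_inv h1, ψ.left_inv hm, w.one_act]
    refine ⟨hm, ?_⟩
    have h3 := e₀.map_source h0
    rw [(hP 0 h0).1, Function.comp_apply, this] at h3
    exact h3
  · intro x hx
    have hd : Module.finrank ℝ (LinearMap.range (w.derivAlong φ x).toLinearMap) =
        Module.finrank ℝ (LinearMap.range T.toLinearMap) := by
      rw [w.finrank_range_derivAlong (mdifferentiableAt_of_mem_maximalAtlas_infty hφ hx)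
        (mfderiv_injective_of_mem_maximalAtlas hφ hx), hT,
        w.finrank_range_derivAlong (mdifferentiableAt_of_mem_maximalAtlas_infty hψ hm)
        (mfderiv_injective_of_mem_maximalAtlas hψ hm)]
      exact hw x m
    -- Dimensions agree by semi-regularity, so it suffices that each `u ∈ ker π` is a value at `x`
    -- of a generator.
    refine Submodule.eq_of_le_of_finrank_eq ?_ (by rw [hd, hker])
    intro u hu
    have hu : π u = 0 := hu
    have he := hφs x hx
    set e := φ x
    -- The points `e + t • u` have the same `π`-value, hence the same base point `σ`. Thus `c t`
    -- moves `x` along this line in the chart, and `c' 1` generates `u`.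
    let c : ℝ → G := fun t => L.mul (γ (e + t • u)) (L.inv (γ e))
    have hline : ContDiff ℝ ∞ (fun t : ℝ => e + t • u) :=
      contDiff_const.add (contDiff_id.smul contDiff_const)
    have hline0 : e + (0 : ℝ) • u = e := by simp
    have hcγ : ContMDiffAt 𝓘(ℝ, ℝ) 𝓘(ℝ, F) ∞ (fun t : ℝ => γ (e + t • u)) 0 :=
      ContMDiffAt.comp_of_eq (g := γ) (f := fun t : ℝ => e + t • u)
        (hγs e he) (contMDiffAt_iff_contDiffAt.2 hline.contDiffAt) hline0
    have hγ0 : γ (e + (0 : ℝ) • u) = γ e := by rw [hline0]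
    have hc : MDifferentiableAt 𝓘(ℝ, ℝ) 𝓘(ℝ, F) c 0 :=
      (ContMDiffAt.comp_of_eq (g := fun g => L.mul g (L.inv (γ e)))
        (f := fun t : ℝ => γ (e + t • u)) (w.contMDiffAt_mul_inv (hdom e he))
        hcγ hγ0).mdifferentiableAt (by simp)
    have hc0 : c 0 = L.one := by
      simp only [c, hγ0]
      exact L.mul_inv _ (w.inv_mem _ _ (hdom e he)).1
    obtain ⟨c', hc'⟩ : ∃ c' : ℝ →L[ℝ] F, HasMFDerivAt 𝓘(ℝ, ℝ) 𝓘(ℝ, F) c 0 c' :=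
      ⟨_, hc.hasMFDerivAt⟩
    have hD := (w.hasMFDerivAt_comp_act
      (mdifferentiableAt_of_mem_maximalAtlas_infty hφ hx) hc0 rfl).comp 0 hc'
    have hev : ∀ᶠ t : ℝ in 𝓝 0, φ (w.act (c t) x) = e + t • u := by
      have h4 := hcγ.continuousAt.eventually
        (by simpa only [hγ0] using w.eventually_act_eq (hdom e he))
      have h5 : ∀ᶠ t : ℝ in 𝓝 0, e + t • u ∈ e₀.source :=
        hline.continuous.continuousAt.eventually
          (e₀.open_source.mem_nhds (by simpa only [hline0] using he))
      filter_upwards [h4, h5] with t h4 h5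
      have h6 := h4.2
      rw [hφact x hx, hσ e (e + t • u) (by simp [hu])] at h6
      simp only [c]
      rw [h6, hφinv _ h5]
    have hD' : HasFDerivAt (fun t => φ (w.act (c t) x)) ((w.derivAlong φ x).comp c') 0 :=
      hasMFDerivAt_iff_hasFDerivAt.1 hD
    have hlin : HasDerivAt (fun t : ℝ => e + t • u) u 0 := by
      simpa using ((hasDerivAt_id (0 : ℝ)).smul_const u).const_add e
    have h7 := DFunLike.congr_fun ((hD'.congr_of_eventuallyEq
      (hev.mono fun t ht => ht.symm)).unique hlin.hasFDerivAt) (1 : ℝ)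
    exact ⟨c' 1, by simpa using h7⟩
  · intro x hx N hN
    have he := hφs x hx
    -- Points on one fibre share `σ`, so `γ (φ x') (γ (φ x))⁻¹` carries `x` to `x'` and is close to
    -- the identity.
    have h4 := (w.eventually_act_eq (hdom _ he)).and ((w.tendsto_mul_inv (hdom _ he)) hN)
    have h5 : ContinuousAt (fun x' => γ (φ x')) x :=
      ContinuousAt.comp (g := γ) (hγs _ he).continuousAt (φ.continuousAt hx)
    filter_upwards [h5.eventually h4, φ.open_source.mem_nhds hx] with x' h6 hx' hxx
    rw [hφact x hx, hσ _ _ hxx.symm, hφact x' hx'] at h6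
    exact ⟨_, h6.2, h6.1⟩

/-- The counterpart of `reach`: by `ker_eq`, `π` kills the directions of the generators, so `π ∘ φ`
has zero derivative along them. -/
theorem IsFlowBox.eventually_eq [IsManifold 𝓘(ℝ, F) ∞ G] {w : LocalAction L E M}
    {φ : OpenPartialHomeomorph M E} {π : E →L[ℝ] E} (h : w.IsFlowBox φ π) {x : M}
    (hx : x ∈ φ.source) : ∀ᶠ g in 𝓝 L.one, π (φ (w.act g x)) = π (φ x) := by
  refine w.eventually_comp_act_eq (f := fun y => π (φ y)) ?_
  filter_upwards [φ.open_source.mem_nhds hx] with y hy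
  have hd := mdifferentiableAt_of_mem_maximalAtlas_infty h.mem_maximalAtlas hy
  have hd' : MDifferentiableAt 𝓘(ℝ, E) 𝓘(ℝ, E) (fun y => π (φ y)) y :=
    MDifferentiableAt.comp (g := π) (f := φ) y π.differentiableAt.mdifferentiableAt hd
  refine ⟨hd', ?_⟩
  have h1 := (w.hasFDerivAt_comp_act hd').unique
    (π.hasFDerivAt.comp _ (w.hasFDerivAt_comp_act hd))
  rw [h1]
  ext v
  have h2 : w.derivAlong φ y v ∈ LinearMap.ker π.toLinearMap := by
    rw [h.ker_eq y hy]
    exact ⟨v, rfl⟩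
  exact h2

/-! ### Countability of the transverse values of an orbit. -/

/-- The orbit through `z` meets the fibres of each flow box in countably many values. -/
theorem countable_image_orbit [IsManifold 𝓘(ℝ, F) ∞ G] [SecondCountableTopology G]
    [SecondCountableTopology M] {w : LocalAction L E M}
    {φ : M → OpenPartialHomeomorph M E} {π : M → E →L[ℝ] E} (hm : ∀ m, m ∈ (φ m).source)
    (h : ∀ m, w.IsFlowBox (φ m) (π m)) (z m : M) :
    ((fun x => π m (φ m x)) '' (w.orbit z ∩ (φ m).source)).Countable := by
  let step : Set M → Set M := fun C => {x' | ∃ x ∈ C, ∃ g, (g, x) ∈ w.dom ∧ w.act g x = x'}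
  have hstep : ∀ C : Set M, (∀ m, ((fun x => π m (φ m x)) '' (C ∩ (φ m).source)).Countable) →
      ∀ m, ((fun x => π m (φ m x)) '' (step C ∩ (φ m).source)).Countable := by
    intro C hC m
    obtain ⟨t, ht, htM⟩ := TopologicalSpace.countable_cover_nhds (f := fun m => (φ m).source)
      fun m => (φ m).open_source.mem_nhds (hm m)
    -- Fix the box `i` and the fibre `c` of the starting point. On `Z i c` the value after one
    -- transformation is locally constant: a nearby `x'` is `k • x` with `k` near `1`, and `g' • (k
    -- • x)` is `k' • (g • x)` with `k'` near `1`.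
    let Z : M → E → Set (G × M) := fun i c => {p | p ∈ w.dom ∧ p.2 ∈ (φ i).source ∧
      π i (φ i p.2) = c ∧ w.act p.1 p.2 ∈ (φ m).source}
    have hZ : ∀ i c, ((fun p : G × M => π m (φ m (w.act p.1 p.2))) '' Z i c).Countable := by
      intro i c
      apply Set.Countable.image_of_eventually_eq
      rintro ⟨g, x⟩ ⟨hd, hi, hc, hgx⟩
      have h1 := w.eventually_act_act hd ((h m).eventually_eq hgx)
      rw [nhds_prod_eq, Filter.eventually_prod_iff] at h1
      obtain ⟨p₁, hp₁, p₂, hp₂, h1⟩ := h1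
      have h2 := (h i).reach x hi _ hp₂
      rw [eventually_nhdsWithin_iff, nhds_prod_eq]
      filter_upwards [hp₁.prod_mk h2]
      rintro ⟨g', x'⟩ ⟨h3, h4⟩ ⟨-, -, hc', -⟩
      obtain ⟨k, hk, -, rfl⟩ := h4 (hc'.trans hc.symm)
      obtain ⟨k', hk', h5⟩ := h1 h3 hk
      exact (congrArg (fun y => π m (φ m y)) h5).trans hk'
    refine (ht.biUnion fun i _ => (hC i).biUnion fun c _ => hZ i c).mono ?_
    rintro _ ⟨_, ⟨⟨x, hx, g, hd, rfl⟩, hgx⟩, rfl⟩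
    obtain ⟨i, hi, hxi⟩ := Set.mem_iUnion₂.1 (htM.symm ▸ Set.mem_univ x)
    exact Set.mem_biUnion hi (Set.mem_biUnion (Set.mem_image_of_mem _ ⟨hx, hxi⟩)
      ⟨(g, x), ⟨hd, hxi, rfl, hgx⟩, rfl⟩)
  have hn : ∀ n : ℕ, ∀ m,
      ((fun x => π m (φ m x)) '' (step^[n] {z} ∩ (φ m).source)).Countable := by
    intro n
    induction n with
    | zero => exact fun m => ((Set.countable_singleton z).mono Set.inter_subset_left).image _
    | succ n ih =>
      rw [Function.iterate_succ_apply']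
      exact hstep _ ih
  have horb : w.orbit z ⊆ ⋃ n : ℕ, step^[n] {z} := by
    intro y hy
    rw [Set.mem_iUnion]
    induction (hy : Relation.ReflTransGen _ z y) with
    | refl => exact ⟨0, rfl⟩
    | tail hab hbc ih =>
      obtain ⟨n, hn⟩ := ih
      refine ⟨n + 1, ?_⟩
      rw [Function.iterate_succ_apply']
      exact ⟨_, hn, hbc⟩
  refine (Set.countable_iUnion fun n => hn n m).mono ?_
  rintro _ ⟨y, ⟨hy, hys⟩, rfl⟩
  obtain ⟨n, hyn⟩ := Set.mem_iUnion.1 (horb hy)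
  exact Set.mem_iUnion.2 ⟨n, y, ⟨hyn, hys⟩, rfl⟩

/-! ### Transversality of slices. -/

/-- This is the group component of the derivative of the jointly smooth `coordAct`, taken at the
identity. -/
theorem continuousAt_derivAlong [IsManifold 𝓘(ℝ, F) ∞ G] (w : LocalAction L E M)
    {φ : OpenPartialHomeomorph M E} (hφ : φ ∈ IsManifold.maximalAtlas 𝓘(ℝ, E) ∞ M) {z : M}
    (hz : z ∈ φ.source) : ContinuousAt (w.derivAlong φ) z := by
  have h1 := (w.eventually_coordAct hφ hz).self_of_nhds.2.2.2.2
  have h2 : ContinuousAt (fderiv ℝ (w.coordAct φ)) (chartAt F L.one L.one, φ z) :=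
    (h1.fderiv_right (m := 0) (by simp)).continuousAt
  have h3 : ContinuousAt (fun x => fderiv ℝ (w.coordAct φ) (chartAt F L.one L.one, φ x)) z :=
    ContinuousAt.comp (g := fderiv ℝ (w.coordAct φ))
      (f := fun x => (chartAt F L.one L.one, φ x)) h2
      (continuousAt_const.prodMk (φ.continuousAt hz))
  refine (h3.clm_comp (continuousAt_const (y := ContinuousLinearMap.inl ℝ F E))).congr ?_
  filter_upwards [φ.open_source.mem_nhds hz] with x hx
  rw [(w.hasFDerivAt_coordAct hφ hx).fderiv]
  ext v
  simp

end LocalAction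

/-- The curve is the straight line through `φ p` in direction `v`, pulled back by the chart. -/
theorem exists_mem_submanifoldTangent
    {E : Type*} [NormedAddCommGroup E] [NormedSpace ℝ E]
    {M : Type*} [TopologicalSpace M] [ChartedSpace E M]
    {φ : OpenPartialHomeomorph M E} (hφ : φ ∈ IsManifold.maximalAtlas 𝓘(ℝ, E) ∞ M)
    {V : Submodule ℝ E} {S : Set M} {p : M} (hp : p ∈ φ.source)
    (hS : ∀ᶠ x in 𝓝 p, φ x - φ p ∈ V → x ∈ S) {v : E} (hv : v ∈ V) :
    ∃ u ∈ submanifoldTangent E S p, mfderiv 𝓘(ℝ, E) 𝓘(ℝ, E) φ p u = v := by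
  let γ : ℝ → M := fun t => φ.symm (φ p + t • v)
  have hline : ContDiff ℝ ∞ (fun t : ℝ => φ p + t • v) :=
    contDiff_const.add (contDiff_id.smul contDiff_const)
  have hline0 : φ p + (0 : ℝ) • v = φ p := by simp
  have hγ : ContMDiffAt 𝓘(ℝ, ℝ) 𝓘(ℝ, E) ∞ γ 0 :=
    ContMDiffAt.comp_of_eq (g := φ.symm) (f := fun t : ℝ => φ p + t • v)
      (contMDiffAt_symm_of_mem_maximalAtlas hφ (φ.map_source hp))
      (contMDiffAt_iff_contDiffAt.2 hline.contDiffAt) hline0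
  have hγ0 : γ 0 = p := by simp only [γ, hline0, φ.left_inv hp]
  have ht : ∀ᶠ t : ℝ in 𝓝 0, φ (γ t) = φ p + t • v := by
    filter_upwards [hline.continuous.continuousAt.eventually
      (φ.open_target.mem_nhds (by simpa only [hline0] using φ.map_source hp))] with t ht
    exact φ.right_inv ht
  have hγS : ∀ᶠ t : ℝ in 𝓝 0, γ t ∈ S := by
    filter_upwards [ht, hγ.continuousAt.eventually (by simpa only [hγ0] using hS)] with t h1 h2
    exact h2 (by rw [h1, add_sub_cancel_left]; exact V.smul_mem t hv)
  refine ⟨(mfderiv 𝓘(ℝ, ℝ) 𝓘(ℝ, E) γ 0 : ℝ →L[ℝ] E) 1,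
    Submodule.subset_span ⟨γ, hγ, hγ0, hγS, rfl⟩, ?_⟩
  obtain ⟨γ', hγ'⟩ : ∃ γ' : ℝ →L[ℝ] E, HasMFDerivAt 𝓘(ℝ, ℝ) 𝓘(ℝ, E) γ 0 γ' :=
    ⟨_, (hγ.mdifferentiableAt (by simp)).hasMFDerivAt⟩
  obtain ⟨φ', hφ'⟩ : ∃ φ' : E →L[ℝ] E, HasMFDerivAt 𝓘(ℝ, E) 𝓘(ℝ, E) φ (γ 0) φ' :=
    ⟨_, ((contMDiffAt_of_mem_maximalAtlas hφ (by rwa [hγ0])).mdifferentiableAt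
      (by simp)).hasMFDerivAt⟩
  have h1 : HasFDerivAt (fun t => φ (γ t)) (φ'.comp γ') 0 :=
    hasMFDerivAt_iff_hasFDerivAt.1 (hφ'.comp 0 hγ')
  have hlin : HasDerivAt (fun t : ℝ => φ p + t • v) v 0 := by
    simpa using ((hasDerivAt_id (0 : ℝ)).smul_const v).const_add (φ p)
  have h2 := DFunLike.congr_fun ((h1.congr_of_eventuallyEq
    (ht.mono fun t h => h.symm)).unique hlin.hasFDerivAt) (1 : ℝ)
  have h3 : φ' (γ' 1) = v := by simpa using h2
  have h4 : HasMFDerivAt 𝓘(ℝ, E) 𝓘(ℝ, E) φ p φ' := by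
    have : ∀ q, q = p → HasMFDerivAt 𝓘(ℝ, E) 𝓘(ℝ, E) φ q φ' →
      HasMFDerivAt 𝓘(ℝ, E) 𝓘(ℝ, E) φ p φ' := by rintro _ rfl h; exact h
    exact this _ hγ0 hφ'
  rw [← h3]
  exact (DFunLike.congr_fun h4.mfderiv _).trans
    (congrArg φ' (DFunLike.congr_fun hγ'.mfderiv (1 : ℝ)))

/-! ### The invariant cross-section. -/

theorem mainTheorem5
    {E : Type*} [NormedAddCommGroup E] [NormedSpace ℝ E] [FiniteDimensional ℝ E]
    {M : Type*} [TopologicalSpace M] [ChartedSpace E M] [IsManifold 𝓘(ℝ, E) ∞ M]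
    [T2Space M] [SecondCountableTopology M]
    {FA : Type*} [NormedAddCommGroup FA] [NormedSpace ℝ FA] [FiniteDimensional ℝ FA]
    {GA : Type*} [TopologicalSpace GA] [ChartedSpace FA GA] [IsManifold 𝓘(ℝ, FA) ∞ GA]
    [T2Space GA] [SecondCountableTopology GA] {LA : LocalLieGroup FA GA}
    {FB : Type*} [NormedAddCommGroup FB] [NormedSpace ℝ FB] [FiniteDimensional ℝ FB]
    {GB : Type*} [TopologicalSpace GB] [ChartedSpace FB GB] [IsManifold 𝓘(ℝ, FB) ∞ GB]
    [T2Space GB] [SecondCountableTopology GB] {LB : LocalLieGroup FB GB}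
    (A : LocalAction LA E M) (B : LocalAction LB E M)
    (hA : A.IsRegular) (hB : B.IsRegular) (z₀ : M)
    (hAB : ∀ᶠ z in 𝓝 z₀, Disjoint (A.orbitTangent z) (B.orbitTangent z)) :
    ∃ U S : Set M, IsOpen U ∧ z₀ ∈ S ∧ S ⊆ U ∧
      A.IsCrossSection S ∧ B.IsInvariantWithin S U := by
  choose Φ ϖ hm hbox using B.exists_isFlowBox hB.1
  set φ := Φ z₀
  set π := ϖ z₀
  have hz₀ : z₀ ∈ φ.source := hm z₀
  have hφ : φ ∈ IsManifold.maximalAtlas 𝓘(ℝ, E) ∞ M := (hbox z₀).mem_maximalAtlas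
  have hdiff : ∀ x ∈ φ.source, MDifferentiableAt 𝓘(ℝ, E) 𝓘(ℝ, E) φ x := fun x hx =>
    mdifferentiableAt_of_mem_maximalAtlas_infty hφ hx
  have hinj : ∀ x ∈ φ.source, Function.Injective (mfderiv 𝓘(ℝ, E) 𝓘(ℝ, E) φ x) := fun x hx =>
    mfderiv_injective_of_mem_maximalAtlas hφ hx
  have hdisj : Disjoint (LinearMap.range (B.derivAlong φ z₀).toLinearMap)
      (LinearMap.range (A.derivAlong φ z₀).toLinearMap) := by
    rw [Submodule.disjoint_def]
    rintro _ ⟨Y, rfl⟩ ⟨X, hX⟩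
    simp only [ContinuousLinearMap.coe_coe] at hX ⊢
    rw [A.derivAlong_apply (hdiff _ hz₀), B.derivAlong_apply (hdiff _ hz₀)] at hX
    have h1 : A.generator z₀ X = B.generator z₀ Y := hinj _ hz₀ hX
    have h2 : B.generator z₀ Y = 0 := Submodule.disjoint_def.1 hAB.self_of_nhds _
      ⟨X, h1⟩ ⟨Y, rfl⟩
    rw [B.derivAlong_apply (hdiff _ hz₀), h2]
    exact map_zero _
  -- `V` contains the `B`-directions, for invariance, and is complementary to the `A`-directions,
  -- for transversality.
  obtain ⟨V, hBV, hVA⟩ := hdisj.exists_isCompl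
  let T : M → FA × V →L[ℝ] E := fun x => (A.derivAlong φ x).coprod V.subtypeL
  have hTc : ContinuousAt T z₀ :=
    (ContinuousLinearMap.coprodEquivL ℝ).continuous.continuousAt.comp
      ((A.continuousAt_derivAlong hφ hz₀).prodMk continuousAt_const)
  have hT₀ : Function.Surjective (T z₀) := by
    intro u
    obtain ⟨v, hv, _, ⟨X, rfl⟩, rfl⟩ := Submodule.mem_sup.1
      (hVA.sup_eq_top ▸ Submodule.mem_top : u ∈ V ⊔ _)
    exact ⟨(X, ⟨v, hv⟩), by simp [T, add_comm]⟩
  have hT := hTc.eventually_surjective hT₀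
  -- `U` lies in the chart and in the set where `V` and the `A`-directions still span, and meets
  -- each `B`-orbit in a connected set.
  obtain ⟨U, hUo, hzU, hUW, hUc⟩ := hB.2 z₀ _
    (Filter.inter_mem (φ.open_source.mem_nhds hz₀) hT)
  refine ⟨U, {x | x ∈ U ∧ φ x - φ z₀ ∈ V}, hUo, ⟨hzU, by simp⟩, fun x hx => hx.1,
    ⟨Module.finrank ℝ V, ?_, ?_⟩, ?_⟩
  · rintro p ⟨hpU, hpV⟩
    refine ⟨φ.restrOpen U hUo, ?_, ⟨(hUW hpU).1, hpU⟩, V, rfl, ?_⟩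
    · exact OpenPartialHomeomorph.mem_maximalAtlas_of_contMDiffOn _
        ((contMDiffOn_of_mem_maximalAtlas hφ).mono fun x hx => hx.1)
        ((contMDiffOn_symm_of_mem_maximalAtlas hφ).mono fun x hx => hx.1)
    · rintro x ⟨-, hxU⟩
      have : φ x - φ z₀ = (φ x - φ p) + (φ p - φ z₀) := by abel
      change (x ∈ U ∧ φ x - φ z₀ ∈ V) ↔ φ x - φ p ∈ V
      rw [this, V.add_mem_iff_left hpV]
      exact and_iff_right hxU
  · rintro p ⟨hpU, hpV⟩
    obtain ⟨hps, hTp⟩ := hUW hpU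
    constructor
    · rw [hA.1 p z₀, ← A.finrank_range_derivAlong (hdiff _ hz₀) (hinj _ hz₀)]
      exact Submodule.finrank_add_eq_of_isCompl hVA
    · rw [eq_top_iff]
      rintro u -
      obtain ⟨⟨X, v, hv⟩, hXv⟩ := hTp (mfderiv 𝓘(ℝ, E) 𝓘(ℝ, E) φ p u)
      obtain ⟨u', hu', rfl⟩ := exists_mem_submanifoldTangent (S := {x | x ∈ U ∧ φ x - φ z₀ ∈ V})
        hφ hps (by
          filter_upwards [hUo.mem_nhds hpU] with x hxU hx
          refine ⟨hxU, ?_⟩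
          have : φ x - φ z₀ = (φ x - φ p) + (φ p - φ z₀) := by abel
          rw [this]
          exact V.add_mem hx hpV) hv
      have h1 : mfderiv 𝓘(ℝ, E) 𝓘(ℝ, E) φ p (u' + A.generator p X) =
          mfderiv 𝓘(ℝ, E) 𝓘(ℝ, E) φ p u := by
        rw [map_add]
        refine Eq.trans ?_ hXv
        refine Eq.trans ?_ (add_comm _ _)
        exact congrArg _ (A.derivAlong_apply (hdiff p hps) X).symm
      rw [← hinj p hps h1]
      exact Submodule.add_mem_sup hu' ⟨X, rfl⟩
  · rintro z ⟨hzU, hzV⟩ y ⟨hy, hyU⟩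
    refine ⟨hyU, ?_⟩
    have hcont : ContinuousOn (fun x => π (φ x)) (B.orbit z ∩ U) :=
      π.continuous.comp_continuousOn (φ.continuousOn.mono fun x hx => (hUW hx.2).1)
    have hss : B.orbit z ∩ U ⊆ B.orbit z ∩ φ.source :=
      Set.inter_subset_inter_right _ fun x hx => (hUW hx).1
    -- A countable subset of `E` is totally disconnected, so its preconnected subsets have at most
    -- one point.
    have hsub : ((fun x => π (φ x)) '' (B.orbit z ∩ U)).Subsingleton := ((LocalAction.countable_image_orbit hm hbox z z₀).mono
      (Set.image_mono hss)).isTotallyDisconnected _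
      subset_rfl ((hUc z).image _ hcont)
    have heq : π (φ y) = π (φ z) :=
      hsub (Set.mem_image_of_mem (fun x => π (φ x)) (Set.mem_inter hy hyU))
        (Set.mem_image_of_mem (fun x => π (φ x)) (Set.mem_inter Relation.ReflTransGen.refl hzU))
    have hmem : φ y - φ z ∈ V := by
      apply hBV
      rw [← (hbox z₀).ker_eq z₀ hz₀]
      change π (φ y - φ z) = 0
      rw [map_sub, heq, sub_self]
    have : φ y - φ z₀ = (φ y - φ z) + (φ z - φ z₀) := by abel
    rw [this]
    exact V.add_mem hmem hzV
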